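/- For $f:[0,1]\to\mathbb R$ and $n\ge 1$ let $B_nf(x)=\sum_{j=0}^n f(j/n)\binom nj x^j(1-x)^{n-j}$ be the $n$th Bernstein polynomial of $f$, write $y_+=\max(0,y)$, let $S_n(1/2)$ be a binomial random variable with parameters $n$ and $1/2$, and let $Z$ be a standard normal random variable. (a) Let $s>0$ and $f_s(t)=\left(t-\tfrac12\right)_+^s$, $t\in[0,1]$. Then $f_s$ is continuous on $[0,1]$ and vanishes on $[0,1/2)$, $\mathbb E|Z|^s<\infty$, for every $n\ge1$ $$B_nf_s\left(\tfrac12\right)-f_s\left(\tfrac12\right)=\tfrac12\,\mathbb E\left|\frac{S_n(1/2)}n-\frac12\right|^s,$$ and $$B_nf_s\left(\tfrac12\right)-f_s\left(\tfrac12\right)\sim \frac{1}{2^{s+1}}\,\mathbb E|Z|^s\,\frac1{n^{s/2}},\qquad n\to\infty,$$ where $u_n\sim v_n$ means $u_n/v_n\to1$. In particular, there is no exponential rate of decay at the endpoint $1/2$: for no $C>0$ is $B_nf_s(1/2)-f_s(1/2)=O(e^{-Cn})$ as $n\to\infty$. (b) Let $0<b<1$ and let $f=1_{[b,1]}$ be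 the indicator function of $[b,1]$, which vanishes on $[0,b)$. Then $$\lim_{n\to\infty}B_nf(b)=\tfrac12\ne 1=f(b);$$ in particular $B_nf(b)$ does not converge to $f(b)$. -/

import Mathlib

/-- The `n`th Bernstein polynomial of `f`, evaluated at `x`. For `0 ≤ x ≤ 1` and `n ≥ 1` it depends
only on the restriction of `f` to `[0, 1]`. -/
noncomputable def bernsteinOp (n : ℕ) (f : ℝ → ℝ) (x : ℝ) : ℝ :=
  ∑ j ∈ Finset.range (n + 1), f ((j : ℝ) / n) * (n.choose j : ℝ) * x ^ j * (1 - x) ^ (n - j)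

/-- The function `f_s(t) = (t - 1/2)_+ ^ s`. -/
noncomputable def halfPosPow (s t : ℝ) : ℝ := (max 0 (t - 1 / 2)) ^ s

/-- The success probability `1/2`, as a point of the unit interval. -/
noncomputable def halfProb : unitInterval := ⟨1 / 2, by norm_num, by norm_num⟩

/-- The absolute moment `E |Z| ^ s` of a standard normal random variable `Z`. -/
noncomputable def absNormalMoment (s : ℝ) : ℝ :=
  ∫ z, |z| ^ s ∂(ProbabilityTheory.gaussianReal 0 1)

/-- `E |S_n / n - 1/2| ^ s`, where `S_n` is binomial with parameters `n` and `1/2`. -/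
noncomputable def absBinomialMoment (n : ℕ) (s : ℝ) : ℝ :=
  ∫ k : ℕ, |(k : ℝ) / n - 1 / 2| ^ s ∂(ProbabilityTheory.binomial n halfProb)

open MeasureTheory ProbabilityTheory Filter Topology

/-! Everything is read off from De Moivre–Laplace, since `B_n f(p) = E f(S_n/n)`. In (a), the
symmetry of `S_n` about `n/2` makes the two one-sided moments equal, so `B_n f_s(1/2)` is half the
absolute moment. As `S_n/n - 1/2 = X_n/(2√n)` with `X_n` standardized, the rate follows from
`E|X_n|^s → E|Z|^s`. Weak convergence alone does not give this; a bound on `E|X_n|^(2s)` uniform in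
`n`, from sub-Gaussian exponential moments, does. In (b), `B_n f(b) = P(X_n ≥ 0) → P(Z ≥ 0) = 1/2`.
-/

/-- A Bernstein polynomial is an expectation with respect to a binomial distribution. -/
lemma bernsteinOp_eq_integral (n : ℕ) (f : ℝ → ℝ) (p : unitInterval) :
    bernsteinOp n f p = ∫ k : ℕ, f ((k : ℝ) / n) ∂(binomial n p) := by
  rw [integral_binomial, bernsteinOp, Nat.range_succ_eq_Iic]
  refine Finset.sum_congr rfl fun k _ => ?_
  rw [smul_eq_mul]
  ring

/-- Complex `a` lets one binomial expansion serve both the characteristic function and the real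
exponential moments. -/
lemma integral_cexp_sub_mean_binomial (n : ℕ) (p : unitInterval) (a : ℂ) :
    ∫ k : ℕ, Complex.exp (a * ((k : ℂ) - n * (p : ℝ))) ∂(binomial n p) =
      ((p : ℝ) * Complex.exp (a * (1 - (p : ℝ))) +
        (1 - (p : ℝ)) * Complex.exp (-(a * (p : ℝ)))) ^ n := by
  rw [integral_binomial, add_pow, Nat.range_succ_eq_Iic]
  refine Finset.sum_congr rfl fun k hk => ?_
  obtain ⟨m, rfl⟩ := Nat.exists_eq_add_of_le (Finset.mem_Iic.1 hk)
  rw [Nat.add_sub_cancel_left, mul_pow, mul_pow, ← Complex.exp_nat_mul, ← Complex.exp_nat_mul,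
    Complex.real_smul]
  have h : Complex.exp (a * ((k : ℂ) - (k + m : ℕ) * (p : ℝ))) =
      Complex.exp (k * (a * (1 - (p : ℝ)))) * Complex.exp (m * -(a * (p : ℝ))) := by
    rw [← Complex.exp_add]
    congr 1
    push_cast
    ring
  rw [h]
  push_cast
  ring

lemma integral_exp_sub_half_binomial (n : ℕ) (a : ℝ) :
    ∫ k : ℕ, Real.exp (a * ((k : ℝ) - n / 2)) ∂(binomial n halfProb) =
      Real.cosh (a / 2) ^ n := by
  apply Complex.ofReal_injective
  rw [← integral_complex_ofReal]
  have h := integral_cexp_sub_mean_binomial n halfProb a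
  have hp : ((halfProb : ℝ) : ℂ) = 1 / 2 := by simp [halfProb]
  rw [hp] at h
  have e : ∀ k : ℕ, ((Real.exp (a * ((k : ℝ) - n / 2)) : ℝ) : ℂ) =
      Complex.exp (a * ((k : ℂ) - n * (1 / 2))) := by
    intro k
    push_cast
    congr 2
    ring
  simp_rw [e, h]
  push_cast
  rw [Complex.cosh]
  congr 1
  rw [show (a : ℂ) * (1 - 1 / 2) = a / 2 by ring, show -((a : ℂ) * (1 / 2)) = -(a / 2) by ring]
  ring

/-! ### Central limit theorem for the binomial law -/

/-- The law of `(S - n p) / √(n p (1 - p))` for `S` binomial with parameters `n` and `p`. -/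
noncomputable def standardBinomial (n : ℕ) (p : unitInterval) : ProbabilityMeasure ℝ :=
  ⟨(binomial n p).map fun k : ℕ => (√n)⁻¹ * (((k : ℝ) - n * p) / √(p * (1 - p))),
    Measure.isProbabilityMeasure_map .of_discrete⟩

lemma integral_standardBinomial {E : Type*} [NormedAddCommGroup E] [NormedSpace ℝ E]
    (n : ℕ) (p : unitInterval) {f : ℝ → E}
    (hf : StronglyMeasurable f) :
    ∫ x, f x ∂(standardBinomial n p : Measure ℝ) =
      ∫ k : ℕ, f ((√n)⁻¹ * (((k : ℝ) - n * p) / √(p * (1 - p)))) ∂(binomial n p) :=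
  integral_map .of_discrete hf.aestronglyMeasurable

lemma charFun_standardBinomial (n : ℕ) (p : unitInterval) (t : ℝ) :
    charFun (standardBinomial n p : Measure ℝ) t =
      charFun ((binomial 1 p).map fun k : ℕ => ((k : ℝ) - p) / √(p * (1 - p))) ((√n)⁻¹ * t) ^ n := by
  rw [charFun_apply_real, charFun_apply_real,
    integral_standardBinomial _ _ (by fun_prop), integral_map .of_discrete (by fun_prop)]
  set a : ℂ := t * (((√n)⁻¹ : ℝ) : ℂ) * (((√(p * (1 - p)))⁻¹ : ℝ) : ℂ) * Complex.I with ha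
  have h₁ := integral_cexp_sub_mean_binomial n p a
  have h₂ := integral_cexp_sub_mean_binomial 1 p a
  rw [pow_one] at h₂
  rw [← h₂] at h₁
  convert h₁ using 4 with k
  · rw [ha]; push_cast; ring_nf
  · rw [ha]; push_cast; ring_nf

/-- **De Moivre–Laplace theorem**: the standardized binomial distributions converge weakly to the
standard normal distribution. -/
lemma tendsto_standardBinomial (p : unitInterval) (hp0 : 0 < (p : ℝ)) (hp1 : (p : ℝ) < 1) :
    Tendsto (fun n => standardBinomial n p) atTop
      (𝓝 (⟨gaussianReal 0 1, inferInstance⟩ : ProbabilityMeasure ℝ)) := by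
  refine ProbabilityMeasure.tendsto_iff_tendsto_charFun.2 fun t => ?_
  simp_rw [charFun_standardBinomial]
  have hv : 0 < (p : ℝ) * (1 - p) := mul_pos hp0 (sub_pos.2 hp1)
  have h := tendsto_charFun_inv_sqrt_mul_pow (P := binomial 1 p)
    (X := fun k : ℕ => ((k : ℝ) - p) / √(p * (1 - p))) .of_discrete
    (by
      rw [integral_binomial, ← Nat.range_succ_eq_Iic, Finset.sum_range_succ,
        Finset.sum_range_one]
      simp
      ring)
    (by
      rw [integral_binomial, ← Nat.range_succ_eq_Iic, Finset.sum_range_succ,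
        Finset.sum_range_one]
      simp only [Pi.pow_apply, div_pow, Real.sq_sqrt hv.le]
      have : (1 - (p : ℝ)) ≠ 0 := (sub_pos.2 hp1).ne'
      simp
      field_simp
      ring) t
  simpa [charFun_gaussianReal, neg_div] using h

/-! ### From weak convergence to convergence of moments -/

lemma abs_integral_sub_integral_min_le {μ : Measure ℝ} [IsProbabilityMeasure μ] {f : ℝ → ℝ}
    (hf : Continuous f) (hf2 : Integrable (fun x => f x ^ 2) μ)
    {K M : ℝ} (hK : ∫ x, f x ^ 2 ∂μ ≤ K) (hM : 0 < M) :
    |∫ x, f x ∂μ - ∫ x, min (f x) M ∂μ| ≤ K / M := by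
  have hint : Integrable f μ :=
    ((memLp_two_iff_integrable_sq hf.aestronglyMeasurable).2 hf2).integrable (by norm_num)
  have hmin : Integrable (fun x => min (f x) M) μ := hint.inf (integrable_const M)
  -- The excess vanishes where `f ≤ M`; elsewhere it is at most `f ≤ f²/M`.
  have hpt : ∀ x, f x - min (f x) M ≤ f x ^ 2 / M := by
    intro x
    rw [le_div_iff₀ hM]
    rcases le_total (f x) M with h | h
    · simp [h, sq_nonneg]
    · rw [min_eq_right h]; nlinarith
  rw [← integral_sub hint hmin, abs_of_nonneg
    (integral_nonneg fun x => sub_nonneg.2 (min_le_left _ _))]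
  calc ∫ x, f x - min (f x) M ∂μ ≤ ∫ x, f x ^ 2 / M ∂μ :=
        integral_mono (hint.sub hmin) (hf2.div_const M) hpt
    _ = (∫ x, f x ^ 2 ∂μ) / M := integral_div _ _
    _ ≤ K / M := by gcongr

/-- Weak convergence together with bounded second moments of `f` gives convergence of the
integrals of `f`. -/
lemma tendsto_integral_of_tendsto_of_sq_bounded {ι : Type*} {l : Filter ι}
    {μs : ι → ProbabilityMeasure ℝ}
    {μ : ProbabilityMeasure ℝ} (h : Tendsto μs l (𝓝 μ)) {f : ℝ → ℝ}
    (hf : Continuous f) (hf0 : ∀ x, 0 ≤ f x) {K : ℝ}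
    (hint : ∀ n, Integrable (fun x => f x ^ 2) (μs n : Measure ℝ))
    (hK : ∀ n, ∫ x, f x ^ 2 ∂(μs n : Measure ℝ) ≤ K)
    (hint' : Integrable (fun x => f x ^ 2) (μ : Measure ℝ)) :
    Tendsto (fun n => ∫ x, f x ∂(μs n : Measure ℝ)) l (𝓝 (∫ x, f x ∂(μ : Measure ℝ))) := by
  rw [Metric.tendsto_nhds]
  intro ε hε
  set K' := max (max K (∫ x, f x ^ 2 ∂(μ : Measure ℝ))) 1
  have hK'0 : 0 < K' := lt_of_lt_of_le one_pos (le_max_right _ _)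
  -- With this level each of the two truncation errors is at most `ε/3`.
  set M := 3 * K' / ε
  have hM : 0 < M := by positivity
  have hKM : K' / M = ε / 3 := by simp only [M]; field_simp
  let g : BoundedContinuousFunction ℝ ℝ := .ofNormedAddCommGroup (fun x => min (f x) M)
    (by fun_prop) M fun x => by
      rw [Real.norm_of_nonneg (le_min (hf0 x) hM.le)]
      exact min_le_right _ _
  have hg := ProbabilityMeasure.tendsto_iff_forall_integral_tendsto.1 h g
  filter_upwards [Metric.tendsto_nhds.1 hg (ε / 3) (by positivity)] with n hn
  have h₁ := abs_integral_sub_integral_min_le hf (hint n)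
    ((hK n).trans ((le_max_left _ _).trans (le_max_left _ _) : K ≤ K')) hM
  have h₂ := abs_integral_sub_integral_min_le hf hint'
    ((le_max_right _ _).trans (le_max_left _ _) : _ ≤ K') hM
  change |∫ x, min (f x) M ∂(μs n : Measure ℝ) - ∫ x, min (f x) M ∂(μ : Measure ℝ)| < ε / 3 at hn
  rw [hKM] at h₁ h₂
  rw [Real.dist_eq]
  rw [abs_lt] at *
  rw [abs_le] at *
  constructor <;> linarith [h₁.1, h₁.2, h₂.1, h₂.2, hn.1, hn.2]

lemma sqrt_halfProb_mul_one_sub : √((halfProb : ℝ) * (1 - halfProb)) = 1 / 2 := by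
  rw [show (halfProb : ℝ) * (1 - halfProb) = (1 / 2) ^ 2 by simp [halfProb]; norm_num]
  exact Real.sqrt_sq (by norm_num)

/-- The integral is `cosh(t/√n)^n`, and `cosh y ≤ exp(y²/2)` removes the dependence on `n`. -/
lemma integral_exp_mul_standardBinomial_half_le (n : ℕ) {t : ℝ} (ht : t ^ 2 = 1) :
    ∫ x, Real.exp (t * x) ∂(standardBinomial n halfProb : Measure ℝ) ≤ Real.exp (1 / 2) := by
  rw [integral_standardBinomial _ _ (by fun_prop), sqrt_halfProb_mul_one_sub]
  have e : ∀ k : ℕ, t * ((√n)⁻¹ * (((k : ℝ) - n * (halfProb : ℝ)) / (1 / 2))) =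
      (2 * t * (√n)⁻¹) * ((k : ℝ) - n / 2) := by
    intro k
    simp only [halfProb]
    ring
  simp_rw [e, integral_exp_sub_half_binomial]
  calc Real.cosh (2 * t * (√n)⁻¹ / 2) ^ n
      ≤ Real.exp ((2 * t * (√n)⁻¹ / 2) ^ 2 / 2) ^ n := by
        gcongr
        exact Real.cosh_le_exp_half_sq _
    _ = Real.exp (n * ((2 * t * (√n)⁻¹ / 2) ^ 2 / 2)) := (Real.exp_nat_mul _ _).symm
    _ ≤ Real.exp (1 / 2) := by
        gcongr
        rw [show (2 * t * (√n)⁻¹ / 2) ^ 2 = t ^ 2 * ((√n) ^ 2)⁻¹ by ring, ht,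
          Real.sq_sqrt n.cast_nonneg]
        -- For `n = 0` the convention `0⁻¹ = 0` makes the exponent zero.
        rcases eq_or_ne (n : ℝ) 0 with h | h
        · simp [h]
        · field_simp; rfl

lemma integrable_standardBinomial (n : ℕ) (p : unitInterval) {f : ℝ → ℝ} (hf : Measurable f) :
    Integrable f (standardBinomial n p : Measure ℝ) :=
  (integrable_map_measure hf.aestronglyMeasurable .of_discrete).2 (integrable_binomial _)

lemma integral_rpow_abs_standardBinomial_half_le (n : ℕ) {r : ℝ} (hr : 0 ≤ r) :
    ∫ x, |x| ^ r ∂(standardBinomial n halfProb : Measure ℝ) ≤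
      r ^ r * (2 * Real.exp (1 / 2)) := by
  have h₁ := integral_exp_mul_standardBinomial_half_le n (t := 1) (by norm_num)
  have h₂ := integral_exp_mul_standardBinomial_half_le n (t := -1) (by norm_num)
  calc ∫ x, |x| ^ r ∂(standardBinomial n halfProb : Measure ℝ)
      ≤ ∫ x, r ^ r * (Real.exp (1 * x) + Real.exp (-1 * x))
          ∂(standardBinomial n halfProb : Measure ℝ) := by
        refine integral_mono (integrable_standardBinomial _ _ (by fun_prop))
          (integrable_standardBinomial _ _ (by fun_prop)) fun x => ?_
        refine (rpow_abs_le_mul_max_exp_of_pos x hr one_pos).trans ?_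
        rw [div_one]
        gcongr
        exact max_le_add_of_nonneg (Real.exp_pos _).le (Real.exp_pos _).le
    _ ≤ r ^ r * (2 * Real.exp (1 / 2)) := by
        rw [integral_const_mul, integral_add (integrable_standardBinomial _ _ (by fun_prop))
          (integrable_standardBinomial _ _ (by fun_prop))]
        gcongr
        linarith

lemma integrable_rpow_abs_gaussianReal {r : ℝ} (hr : 0 ≤ r) :
    Integrable (fun z : ℝ => |z| ^ r) (gaussianReal 0 1) :=
  integrable_rpow_abs_of_integrable_exp_mul (X := fun z => z) one_ne_zero
    (integrable_exp_mul_gaussianReal _) (integrable_exp_mul_gaussianReal _) hr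

/-- Convergence of the absolute moments of the standardized symmetric binomial distributions. -/
lemma tendsto_integral_rpow_abs_standardBinomial_half {s : ℝ} (hs : 0 < s) :
    Tendsto (fun n => ∫ x, |x| ^ s ∂(standardBinomial n halfProb : Measure ℝ)) atTop
      (𝓝 (absNormalMoment s)) := by
  have e : (fun x : ℝ => (|x| ^ s) ^ 2) = fun x => |x| ^ (s * 2) := by
    ext x
    rw [Real.rpow_mul (abs_nonneg x), ← Real.rpow_natCast]
    norm_num
  refine tendsto_integral_of_tendsto_of_sq_bounded
    (tendsto_standardBinomial halfProb (by norm_num [halfProb]) (by norm_num [halfProb]))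
    (continuous_abs.rpow_const fun _ => .inr hs.le) (fun x => by positivity)
    (K := (s * 2) ^ (s * 2) * (2 * Real.exp (1 / 2)))
    (fun n => integrable_standardBinomial _ _ (by fun_prop)) (fun n => ?_) ?_
  · simp only [e]
    exact integral_rpow_abs_standardBinomial_half_le n (by positivity)
  · simp only [e]
    exact integrable_rpow_abs_gaussianReal (by positivity)

/-! ### Part (a): exact formula and polynomial rate -/

lemma absBinomialMoment_eq {n : ℕ} (hn : 1 ≤ n) (s : ℝ) :
    absBinomialMoment n s = (2 : ℝ) ^ (-s) * (n : ℝ) ^ (-s / 2) *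
      ∫ x, |x| ^ s ∂(standardBinomial n halfProb : Measure ℝ) := by
  have hn0 : (0 : ℝ) < n := by exact_mod_cast hn
  rw [integral_standardBinomial _ _ (by fun_prop), sqrt_halfProb_mul_one_sub,
    ← integral_const_mul, absBinomialMoment]
  congr 1 with k
  have h₂ : (n : ℝ) ^ (-s / 2) = (√n) ^ (-s) := by
    rw [Real.sqrt_eq_rpow, ← Real.rpow_mul hn0.le]
    congr 1
    ring
  have hsq : 0 < √(n : ℝ) := Real.sqrt_pos.2 hn0
  have h₃ : |(k : ℝ) / n - 1 / 2| = (2 * √n)⁻¹ *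
      |(√n)⁻¹ * (((k : ℝ) - n * (halfProb : ℝ)) / (1 / 2))| := by
    rw [← abs_of_pos (inv_pos.2 (mul_pos two_pos hsq)), ← abs_mul]
    congr 1
    have : √(n : ℝ) * √n = n := Real.mul_self_sqrt hn0.le
    simp only [halfProb]
    rw [mul_inv, show (2 : ℝ)⁻¹ * (√n)⁻¹ * ((√n)⁻¹ * (((k : ℝ) - n * (1 / 2)) / (1 / 2))) =
      (√n * √n)⁻¹ * ((k : ℝ) - n / 2) by rw [mul_inv]; ring, this]
    field_simp
  rw [h₃, h₂, Real.mul_rpow (by positivity) (abs_nonneg _), Real.inv_rpow (by positivity),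
    ← Real.rpow_neg (by positivity), Real.mul_rpow two_pos.le hsq.le]

/-- The weights are symmetric because `1 - p = p`; truncated subtraction is harmless since `k ≤ n`
throughout the sum. -/
lemma integral_binomial_half_reflect (n : ℕ) (f : ℕ → ℝ) :
    ∫ k, f (n - k) ∂(binomial n halfProb) = ∫ k, f k ∂(binomial n halfProb) := by
  rw [integral_binomial, integral_binomial, ← Nat.range_succ_eq_Iic,
    ← Finset.sum_range_reflect]
  refine Finset.sum_congr rfl fun k hk => ?_
  have hk' : k ≤ n := Nat.lt_succ_iff.1 (Finset.mem_range.1 hk)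
  have e : (halfProb : ℝ) = 1 - halfProb := by norm_num [halfProb]
  rw [show n + 1 - 1 - k = n - k by omega, Nat.sub_sub_self hk', Nat.choose_symm hk', ← e]
  simp only [smul_eq_mul]
  ring

lemma halfPosPow_half {s : ℝ} (hs : 0 < s) : halfPosPow s (1 / 2) = 0 := by
  simp [halfPosPow, Real.zero_rpow hs.ne']

lemma halfPosPow_add_halfPosPow_one_sub {s : ℝ} (hs : 0 < s) (t : ℝ) :
    halfPosPow s t + halfPosPow s (1 - t) = |t - 1 / 2| ^ s := by
  unfold halfPosPow
  rcases le_total t (1 / 2) with h | h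
  · rw [max_eq_left (by linarith), max_eq_right (by linarith), abs_of_nonpos (by linarith),
      Real.zero_rpow hs.ne', zero_add]
    congr 1
    ring
  · rw [max_eq_right (by linarith), max_eq_left (by linarith), abs_of_nonneg (by linarith),
      Real.zero_rpow hs.ne', add_zero]

lemma bernsteinOp_halfPosPow_half {s : ℝ} (hs : 0 < s) {n : ℕ} (hn : 1 ≤ n) :
    bernsteinOp n (halfPosPow s) (1 / 2) - halfPosPow s (1 / 2) =
      1 / 2 * absBinomialMoment n s := by
  have hn0 : (n : ℝ) ≠ 0 := by positivity
  have hB : bernsteinOp n (halfPosPow s) (1 / 2) =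
      ∫ k : ℕ, halfPosPow s ((k : ℝ) / n) ∂(binomial n halfProb) :=
    bernsteinOp_eq_integral n _ halfProb
  have hsum : absBinomialMoment n s = bernsteinOp n (halfPosPow s) (1 / 2) +
      bernsteinOp n (halfPosPow s) (1 / 2) := by
    nth_rw 2 [hB]
    rw [← integral_binomial_half_reflect, hB, ← integral_add (integrable_binomial _)
      (integrable_binomial _), absBinomialMoment, integral_binomial, integral_binomial]
    refine Finset.sum_congr rfl fun k hk => ?_
    rw [← halfPosPow_add_halfPosPow_one_sub hs, Nat.cast_sub (Finset.mem_Iic.1 hk), sub_div,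
      div_self hn0]
  rw [halfPosPow_half hs, hsum]
  ring

lemma absNormalMoment_pos {s : ℝ} (hs : 0 < s) : 0 < absNormalMoment s := by
  rw [absNormalMoment, integral_pos_iff_support_of_nonneg (fun z => by positivity)
    (integrable_rpow_abs_gaussianReal hs.le)]
  have hsupp : Function.support (fun z : ℝ => |z| ^ s) = {0}ᶜ := by
    ext z
    simp [hs.ne']
  have : NullSingletonClass (gaussianReal 0 1) := nullSingletonClass_gaussianReal one_ne_zero
  rw [hsupp, prob_compl_eq_one_sub (measurableSet_singleton 0), measure_singleton]
  norm_num

lemma isEquivalent_bernsteinOp_halfPosPow {s : ℝ} (hs : 0 < s) :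
    Asymptotics.IsEquivalent atTop
      (fun n : ℕ => bernsteinOp n (halfPosPow s) (1 / 2) - halfPosPow s (1 / 2))
      (fun n : ℕ => (2 : ℝ) ^ (-s - 1) * absNormalMoment s * (n : ℝ) ^ (-s / 2)) := by
  have hm : Asymptotics.IsEquivalent atTop
      (fun n : ℕ => ∫ x, |x| ^ s ∂(standardBinomial n halfProb : Measure ℝ))
      (fun _ => absNormalMoment s) :=
    (Asymptotics.isEquivalent_const_iff_tendsto (absNormalMoment_pos hs).ne').2
      (tendsto_integral_rpow_abs_standardBinomial_half hs)
  have h := (Asymptotics.IsEquivalent.refl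
    (u := fun n : ℕ => (2 : ℝ) ^ (-s - 1) * (n : ℝ) ^ (-s / 2)) (l := atTop)).mul hm
  refine (h.congr_left ?_).congr_right ?_
  · filter_upwards [eventually_ge_atTop 1] with n hn
    rw [bernsteinOp_halfPosPow_half hs hn, absBinomialMoment_eq hn,
      Real.rpow_sub two_pos, Real.rpow_one]
    simp only [Pi.mul_apply]
    ring
  · filter_upwards with n
    simp only [Pi.mul_apply]
    ring

/-- Since `exp(-Cn) = o(n^(-s/2))`, such a bound would make a nonvanishing sequence little-o of
itself. -/
lemma not_isBigO_exp_bernsteinOp_halfPosPow {s C : ℝ} (hs : 0 < s) (hC : 0 < C) :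
    ¬ Asymptotics.IsBigO atTop
      (fun n : ℕ => bernsteinOp n (halfPosPow s) (1 / 2) - halfPosPow s (1 / 2))
      (fun n : ℕ => Real.exp (-C * n)) := by
  intro hO
  have hc : (2 : ℝ) ^ (-s - 1) * absNormalMoment s ≠ 0 :=
    mul_ne_zero (by positivity) (absNormalMoment_pos hs).ne'
  have h₁ := (isEquivalent_bernsteinOp_halfPosPow hs).isBigO_symm.trans hO
  have h₂ := (isLittleO_exp_neg_mul_rpow_atTop hC (-s / 2)).comp_tendsto
    (tendsto_natCast_atTop_atTop (R := ℝ))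
  have h₃ := (h₁.trans_isLittleO h₂).trans_isBigO (Asymptotics.isBigO_self_const_mul hc _ _)
  refine Asymptotics.isLittleO_irrefl' (l := atTop) (Eventually.frequently ?_) h₃
  filter_upwards [eventually_ge_atTop 1] with n hn
  have : (0 : ℝ) < n := by exact_mod_cast hn
  exact norm_ne_zero_iff.2 (mul_ne_zero hc (by positivity))

/-! ### Part (b): the indicator function -/

lemma gaussianReal_Ici_zero : (gaussianReal 0 1).real (Set.Ici 0) = 1 / 2 := by
  have : NullSingletonClass (gaussianReal 0 1) := nullSingletonClass_gaussianReal one_ne_zero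
  have hneg : (gaussianReal 0 1).real (Set.Iic 0) = (gaussianReal 0 1).real (Set.Ici 0) := by
    have h := gaussianReal_map_neg (μ := 0) (v := 1)
    rw [neg_zero] at h
    conv_rhs => rw [← h]
    rw [map_measureReal_apply measurable_neg measurableSet_Ici]
    congr 1
    ext x
    simp
  have hio : (gaussianReal 0 1).real (Set.Iio 0) = (gaussianReal 0 1).real (Set.Iic 0) :=
    measureReal_congr Iio_ae_eq_Iic
  have hcompl := probReal_compl_eq_one_sub (μ := gaussianReal 0 1)
    (measurableSet_Ici (a := (0 : ℝ)))
  rw [Set.compl_Ici, hio, hneg] at hcompl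
  linarith

lemma bernsteinOp_indicator_Icc {n : ℕ} (hn : 1 ≤ n) (p : unitInterval) (hp0 : 0 < (p : ℝ))
    (hp1 : (p : ℝ) < 1) :
    bernsteinOp n ((Set.Icc (p : ℝ) 1).indicator fun _ => (1 : ℝ)) p =
      (standardBinomial n p : Measure ℝ).real (Set.Ici 0) := by
  have hn0 : (0 : ℝ) < n := by exact_mod_cast hn
  have hσ : 0 < √((p : ℝ) * (1 - p)) := Real.sqrt_pos.2 (mul_pos hp0 (sub_pos.2 hp1))
  have hsq : 0 < √(n : ℝ) := Real.sqrt_pos.2 hn0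
  rw [← integral_indicator_one measurableSet_Ici, integral_standardBinomial _ _
    (stronglyMeasurable_one.indicator measurableSet_Ici), bernsteinOp_eq_integral,
    integral_binomial, integral_binomial]
  refine Finset.sum_congr rfl fun k hk => ?_
  have hkn : (k : ℝ) ≤ n := by exact_mod_cast Finset.mem_Iic.1 hk
  have hiff : (k : ℝ) / n ∈ Set.Icc (p : ℝ) 1 ↔
      (√(n : ℝ))⁻¹ * (((k : ℝ) - n * p) / √(p * (1 - p))) ∈ Set.Ici (0 : ℝ) := by
    rw [Set.mem_Icc, Set.mem_Ici, mul_nonneg_iff_of_pos_left (inv_pos.2 hsq),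
      le_div_iff₀ hσ, zero_mul, sub_nonneg, le_div_iff₀ hn0, mul_comm (p : ℝ)]
    -- The upper constraint `k/n ≤ 1` is automatic.
    exact and_iff_left ((div_le_one hn0).2 hkn)
  congr 1
  simp only [Set.indicator_apply, hiff, Pi.one_apply]

lemma tendsto_bernsteinOp_indicator_Icc {b : ℝ} (hb0 : 0 < b) (hb1 : b < 1) :
    Tendsto (fun n : ℕ => bernsteinOp n ((Set.Icc b 1).indicator fun _ => (1 : ℝ)) b)
      atTop (𝓝 (1 / 2)) := by
  let p : unitInterval := ⟨b, hb0.le, hb1.le⟩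
  have : NullSingletonClass (gaussianReal 0 1) := nullSingletonClass_gaussianReal one_ne_zero
  -- Portmanteau applies because the frontier `{0}` is Gaussian-null.
  have h := ProbabilityMeasure.tendsto_measure_of_null_frontier_of_tendsto'
    (tendsto_standardBinomial p hb0 hb1) (E := Set.Ici 0) (by simp)
  have h' := (ENNReal.tendsto_toReal (measure_ne_top (gaussianReal 0 1) _)).comp h
  rw [← gaussianReal_Ici_zero]
  refine Tendsto.congr' ?_ h'
  filter_upwards [eventually_ge_atTop 1] with n hn
  exact (bernsteinOp_indicator_Icc hn p hb0 hb1).symm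

theorem mainTheorem5 :
    -- polynomial rate at the endpoint `1/2`, hence no exponential decay
    (∀ s : ℝ, 0 < s →
      ContinuousOn (halfPosPow s) (Set.Icc 0 1) ∧
      (∀ t ∈ Set.Ico (0 : ℝ) (1 / 2), halfPosPow s t = 0) ∧
      MeasureTheory.Integrable (fun z : ℝ => |z| ^ s) (ProbabilityTheory.gaussianReal 0 1) ∧
      (∀ n : ℕ, 1 ≤ n →
        bernsteinOp n (halfPosPow s) (1 / 2) - halfPosPow s (1 / 2) =
          1 / 2 * absBinomialMoment n s) ∧
      Asymptotics.IsEquivalent Filter.atTop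
        (fun n : ℕ => bernsteinOp n (halfPosPow s) (1 / 2) - halfPosPow s (1 / 2))
        (fun n : ℕ => (2 : ℝ) ^ (-s - 1) * absNormalMoment s * (n : ℝ) ^ (-s / 2)) ∧
      (∀ C : ℝ, 0 < C →
        ¬ Asymptotics.IsBigO Filter.atTop
          (fun n : ℕ => bernsteinOp n (halfPosPow s) (1 / 2) - halfPosPow s (1 / 2))
          (fun n : ℕ => Real.exp (-C * n)))) ∧
    -- no convergence at the endpoint `b` for the indicator function of `[b, 1]`
    (∀ b : ℝ, 0 < b → b < 1 →
      (∀ t ∈ Set.Ico (0 : ℝ) b, (Set.Icc b 1).indicator (fun _ => (1 : ℝ)) t = 0) ∧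
      Filter.Tendsto (fun n : ℕ => bernsteinOp n ((Set.Icc b 1).indicator fun _ => (1 : ℝ)) b)
        Filter.atTop (nhds (1 / 2)) ∧
      (Set.Icc b 1).indicator (fun _ => (1 : ℝ)) b = 1 ∧
      ¬ Filter.Tendsto (fun n : ℕ => bernsteinOp n ((Set.Icc b 1).indicator fun _ => (1 : ℝ)) b)
        Filter.atTop (nhds ((Set.Icc b 1).indicator (fun _ => (1 : ℝ)) b))) := by
  refine ⟨fun s hs => ⟨?_, fun t ht => ?_, integrable_rpow_abs_gaussianReal hs.le,
    fun n hn => bernsteinOp_halfPosPow_half hs hn, isEquivalent_bernsteinOp_halfPosPow hs,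
    fun C hC => not_isBigO_exp_bernsteinOp_halfPosPow hs hC⟩, fun b hb0 hb1 => ?_⟩
  · exact ((continuous_const.max (continuous_id.sub continuous_const)).rpow_const
      fun _ => .inr hs.le).continuousOn
  · rw [halfPosPow, max_eq_left (by linarith [ht.2]), Real.zero_rpow hs.ne']
  · have hlim := tendsto_bernsteinOp_indicator_Icc hb0 hb1
    have hb : (Set.Icc b 1).indicator (fun _ => (1 : ℝ)) b = 1 :=
      Set.indicator_of_mem (Set.left_mem_Icc.2 hb1.le) _
    refine ⟨fun t ht => Set.indicator_of_notMem (fun h => ht.2.not_ge h.1) _, hlim, hb,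
      fun h => ?_⟩
    rw [hb] at h
    exact absurd (tendsto_nhds_unique hlim h) (by norm_num)
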